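/- Let $L\ge 0$ and $N>2$ be integers, $q_0=e^{\mathrm{i}\pi/N}$, $[n]_q=\frac{q^n-q^{-n}}{q-q^{-1}}$, $[n]_q!=\prod_{l=1}^n[l]_q$. Let $\sigma_z=\mathrm{diag}(1,-1)$, $\sigma_+=\begin{pmatrix}0&1\\0&0\end{pmatrix}$, $\sigma_-=\begin{pmatrix}0&0\\1&0\end{pmatrix}$. Let $\epsilon_0,\epsilon_1\in\mathbb C$, let $k_\pm=k_\pm(q)$ be complex parameters (constants, or functions of $q\in\mathbb C$ that are continuous at $q_0$), and $w_0=k_+\sigma_++k_-\sigma_-$. On $(\mathbb C^2)^{\otimes L}$ consider $$\mathcal W_i(q)=\sum_{j=1}^L \underbrace{q^{\pm\sigma_z}\otimes\cdots\otimes q^{\pm\sigma_z}}_{j-1}\otimes w_0\otimes \mathbb I\otimes\cdots\otimes\mathbb I+\epsilon_i\, q^{\pm\sigma_z}\otimes\cdots\otimes q^{\pm\sigma_z},$$ with the sign $+$ for $i=0$ and $-$ for $i=1$. Fix $i\in\{0,1\}$, and let $a_2,a_3$ be functions of $q$ near $q_0$, with $a_2$ complex differentiable at $q_0$, such that $a_2+a_3=\epsilon_i$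 and $a_2a_3=-\frac{k_+k_-}{(q-q^{-1})^2}$ near $q_0$. Assume the genericity condition $a_2(q_0)^N\ne a_3(q_0)^N$. Put $\theta_n(q)=a_2(q)q^{L-2n}+a_3(q)q^{-L+2n}$, $\theta_n=\theta_n(q_0)$ and $P_N(x)=\prod_{j=0}^{N-1}(x-\theta_j)$. Then: (a) For all $q\neq q_0$ near $q_0$, $\mathcal W_i(q)$ is diagonalizable and its eigenvalues are exactly the $L+1$ distinct numbers $\theta_0(q),\dots,\theta_L(q)$; let $V_n(q)$ be the eigenspace for $\theta_n(q)$. The numbers $\theta_0,\dots,\theta_{N-1}$ are distinct, $P_N(\mathcal W_i(q_0))=0$, and if $N\le L+1$ then $P_N$ is the minimal polynomial of $\mathcal W_i(q_0)$. (b) The divided polynomial $\mathcal W_i^{[N]}=\lim_{q\to q_0}P_N(\mathcal W_i(q))/[N]_q!$ exists, where $q\to q_0$ in $\mathbb C\setminus\{q_0\}$. So do the limits of subspaces $V_n=\lim_{q\to q_0}V_n(q)$, $n=0,\dots,L$ (written $V_n^*$ when $i=1$); they are non-zero and $(\mathbb C^2)^{\otimes L}=\bigoplus_{n=0}^L V_n$.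 (c) $\mathcal W_i^{[N]}$ acts on $V_n$ as the scalar $$\tilde\theta_n=C_0^{(n)}\Big(\partial_qa_2\,(q^{L-2n+1}-q^{-L+2n+1})+(L-2n)(a_2q^{L-2n}-a_3q^{-L+2n})\Big)\Big|_{q=q_0},$$ $$C_0^{(n)}=-\frac{q_0-q_0^{-1}}{2N\,[N-1]_{q_0}!}\prod_{\substack{0\le j\le N-1\\ j\ne t}}(\theta_t-\theta_j),\qquad n=t+kN,\ k\ge 0,\ 0\le t\le N-1,$$ and $\tilde\theta_0,\dots,\tilde\theta_L$ are all the eigenvalues of $\mathcal W_i^{[N]}$. The eigenspace of $\mathcal W_i^{[N]}$ for $\tilde\theta_n$ is $\bigoplus_{m:\,\tilde\theta_m=\tilde\theta_n}V_m$; so it is $V_n$ for every $n$ if $\tilde\theta_0,\dots,\tilde\theta_L$ are distinct. (d) If $\partial_qa_2(q_0)=0$, in particular if $a_3=0$ near $q_0$, then $\tilde\theta_n=\tilde\theta_0+nd$ for $n=0,\dots,L$ with some $d\neq0$: the eigenvalues are distinct and form an arithmetic progression, and the eigenspace for $\tilde\theta_n$ is $V_n$ for every $n$. -/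

import Mathlib

open Filter Topology Polynomial

namespace OpenXXZ

noncomputable section

/-- The `2 × 2` matrix `q^{σ_z} = diag(q, q⁻¹)`. -/
def qSigmaZ (q : ℂ) : Matrix (Fin 2) (Fin 2) ℂ := !![q, 0; 0, q⁻¹]

/-- `w₀ = k₊ σ₊ + k₋ σ₋`. -/
def w0 (kp km : ℂ) : Matrix (Fin 2) (Fin 2) ℂ :=
  kp • !![0, 1; 0, 0] + km • !![0, 0; 1, 0]

/-- The operator `A₁ ⊗ ⋯ ⊗ A_L` on `(ℂ²)^{⊗ L}`, as a matrix in the product basis, which is indexed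
by the spin configurations `Fin L → Fin 2`. -/
def tensorOp {L : ℕ} (A : Fin L → Matrix (Fin 2) (Fin 2) ℂ) :
    Matrix (Fin L → Fin 2) (Fin L → Fin 2) ℂ :=
  Matrix.of fun s s' => ∏ j, A j (s j) (s' j)

/-- `∑ⱼ r^{σ_z} ⊗ ⋯ ⊗ r^{σ_z} ⊗ w₀ ⊗ 1 ⊗ ⋯ ⊗ 1 + ε r^{σ_z} ⊗ ⋯ ⊗ r^{σ_z}`, with `w₀` on site `j`. -/
def chainOp (L : ℕ) (kp km ε r : ℂ) : Matrix (Fin L → Fin 2) (Fin L → Fin 2) ℂ :=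
  ∑ j : Fin L, tensorOp (fun m => if m < j then qSigmaZ r else if m = j then w0 kp km else 1)
    + ε • tensorOp (fun _ => qSigmaZ r)

/-- The basic operators `𝒲₀` (with `q^{σ_z}` and `ε₀ = ε₊`) and `𝒲₁` (with `q^{-σ_z}` and
`ε₁ = ε₋`) at the value `q`. The boundary parameters `k₊`, `k₋` may depend on `q`. -/
def basicOp (L : ℕ) (kp km : ℂ → ℂ) (ε : Fin 2 → ℂ) (i : Fin 2) (q : ℂ) :
    Matrix (Fin L → Fin 2) (Fin L → Fin 2) ℂ :=
  chainOp L (kp q) (km q) (ε i) (if i = 0 then q else q⁻¹)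

/-- The root of unity `e^{iπ/N}`. -/
def rootq (N : ℕ) : ℂ := Complex.exp (Complex.I * Real.pi / N)

/-- `[n]_q = (qⁿ - q⁻ⁿ) / (q - q⁻¹)`. -/
def qNumber (n : ℕ) (q : ℂ) : ℂ := (q ^ n - (q ^ n)⁻¹) / (q - q⁻¹)

/-- `[n]_q! = [1]_q [2]_q ⋯ [n]_q`. -/
def qFactorial (n : ℕ) (q : ℂ) : ℂ := ∏ l ∈ Finset.Icc 1 n, qNumber l q

/-- `θ_n(q) = a₂(q) q^{L-2n} + a₃(q) q^{-L+2n}`. -/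
def theta (L : ℕ) (a₂ a₃ : ℂ → ℂ) (n : ℕ) (q : ℂ) : ℂ :=
  a₂ q * q ^ ((L : ℤ) - 2 * n) + a₃ q * q ^ (-(L : ℤ) + 2 * n)

/-- `P_N(x) = ∏_{j=0}^{N-1} (x - θ_j)`, with the `θ_j` taken at `q = e^{iπ/N}`. -/
def polyP (L N : ℕ) (a₂ a₃ : ℂ → ℂ) : ℂ[X] :=
  ∏ j ∈ Finset.range N, (X - C (theta L a₂ a₃ j (rootq N)))

/-- `C₀⁽ⁿ⁾ = -(q - q⁻¹) / (2N [N-1]_q!) ∏_{0 ≤ j ≤ N-1, j ≠ t} (θ_t - θ_j)` at `q = e^{iπ/N}`, where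
`t` is the remainder of `n` modulo `N`. -/
def coeffC0 (L N : ℕ) (a₂ a₃ : ℂ → ℂ) (n : ℕ) : ℂ :=
  -(rootq N - (rootq N)⁻¹) / (2 * N * qFactorial (N - 1) (rootq N)) *
    ∏ j ∈ (Finset.range N).erase (n % N),
      (theta L a₂ a₃ (n % N) (rootq N) - theta L a₂ a₃ j (rootq N))

/-- `θ̃_n = C₀⁽ⁿ⁾ (a₂'(q) (q^{L-2n+1} - q^{-L+2n+1}) + (L-2n) (a₂(q) q^{L-2n} - a₃(q) q^{-L+2n}))`
at `q = e^{iπ/N}`. -/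
def thetaTilde (L N : ℕ) (a₂ a₃ : ℂ → ℂ) (n : ℕ) : ℂ :=
  coeffC0 L N a₂ a₃ n *
    (deriv a₂ (rootq N) *
        (rootq N ^ ((L : ℤ) - 2 * n + 1) - rootq N ^ (-(L : ℤ) + 2 * n + 1))
      + ((L : ℂ) - 2 * n) *
        (a₂ (rootq N) * rootq N ^ ((L : ℤ) - 2 * n)
          - a₃ (rootq N) * rootq N ^ (-(L : ℤ) + 2 * n)))

/-- The eigenspace of a matrix for the scalar `μ`, as a subspace of column vectors. -/
abbrev eigSpace {ι : Type} [Fintype ι] [DecidableEq ι] (M : Matrix ι ι ℂ) (μ : ℂ) :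
    Submodule ℂ (ι → ℂ) :=
  Module.End.eigenspace (Matrix.toLin' M) μ

/-- `V` is the limit of the subspaces `U q` along the filter `l` (Painlevé–Kuratowski limit; for
subspaces of a finite-dimensional space this is convergence in the Grassmannian): every vector of
`V` is approximated by vectors of the `U q`, and every vector that is approximated by
vectors of `U q` for arbitrarily late `q` is in `V`. -/
def IsSubspaceLimit {E : Type} [AddCommGroup E] [Module ℂ E] [TopologicalSpace E]
    (l : Filter ℂ) (U : ℂ → Submodule ℂ E) (V : Submodule ℂ E) : Prop :=
  (∀ v ∈ V, ∀ O ∈ 𝓝 v, ∀ᶠ q in l, ((U q : Set E) ∩ O).Nonempty) ∧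
  (∀ v : E, (∀ O ∈ 𝓝 v, ∃ᶠ q in l, ((U q : Set E) ∩ O).Nonempty) → v ∈ V)

end

end OpenXXZ

open OpenXXZ

/-!
The chain operator satisfies `𝒲^{(L+1)} = w₀ ⊗ 1 + r^{σ_z} ⊗ 𝒲^{(L)}` (`chainOp_succ`). Hence on
`ℂ² ⊗ v`, where `v` is an eigenvector of `𝒲^{(L)}` for `θ_n`, the operator `𝒲^{(L+1)}` is the
`2 × 2` matrix `w₀ + θ_n r^{σ_z}`, and trace and determinant show that its eigenvalues are the
`θ_n` and `θ_{n+1}` of length `L + 1` (`siteOp_theta`). Their difference is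
`(q - q⁻¹) (a₂ q^{L-2n} - a₃ q^{-(L-2n)})`. By the genericity condition it does not vanish at
`q₀ = e^{iπ/N}` either, so the spectral projections of the `2 × 2` matrices are continuous at `q₀`.
By induction on `L` the operator `𝒲(q)` has, for all `q` near and including `q₀`, a complete
orthogonal family of nonzero projections `P_n(q)` with `𝒲(q) P_n(q) = θ_n(q) P_n(q)`, continuous
at `q₀` (`exists_spectral_projections`), even though for `N ≤ L` some `θ_n(q)` collide at `q₀`:
`θ_{n+N}(q₀) = θ_n(q₀)`.

The eigenspaces are the ranges of the `P_n(q)`, so their limits are the ranges of the `P_n(q₀)`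
(`isSubspaceLimit_matRange`), which again form a direct sum decomposition. The divided polynomial
is the limit of `∑ n, P_N(θ_n(q)) / [N]_q! • P_n(q)`. Numerator and denominator of the coefficients
have a zero at `q₀`, simple for the denominator, and the quotient of the derivatives is `θ̃_n`
(`tendsto_eval_polyP_div_qFactorial`).

For the arithmetic progression, let `y_j = q₀^{L-2j}`, which for `0 ≤ j < N` are the `N`-th roots of
`(-1)^L`. From `θ_t - θ_j = (y_t - y_j) (a₂ - a₃ / (y_t y_j))` and the factorization of `x^N - z^N`
one gets `P_N'(θ_t) (a₂ y_t - a₃ / y_t) = N (-1)^L (a₂^N - a₃^N)` (`prod_theta_sub_mul`), a nonzero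
number independent of `t`.
-/

namespace OpenXXZ

/-! ### Complete orthogonal families of projection matrices -/

section Projections

variable {ι κ σ : Type} [Fintype ι] [DecidableEq ι] [Fintype κ] [Fintype σ]

/-- The range of a square matrix, as a subspace of column vectors. -/
abbrev matRange (A : Matrix ι ι ℂ) : Submodule ℂ (ι → ℂ) := LinearMap.range (Matrix.toLin' A)

lemma mem_matRange_iff {A : Matrix ι ι ℂ} (hA : A * A = A) {v : ι → ℂ} :
    v ∈ matRange A ↔ A.mulVec v = v := by
  constructor
  · rintro ⟨u, rfl⟩
    rw [Matrix.toLin'_apply, Matrix.mulVec_mulVec, hA]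
  · intro h
    exact ⟨v, by rw [Matrix.toLin'_apply, h]⟩

lemma matRange_ne_bot {A : Matrix ι ι ℂ} (hA : A ≠ 0) : matRange A ≠ ⊥ := by
  rw [Ne, LinearMap.range_eq_bot]
  simpa using hA

/-- Merging the members of a complete orthogonal family along the fibres of a map gives a complete
orthogonal family. -/
lemma CompleteOrthogonalIdempotents.sum_fiber {R : Type} [Ring R] [DecidableEq κ] {e : σ → R}
    (he : CompleteOrthogonalIdempotents e) (f : σ → κ) :
    CompleteOrthogonalIdempotents fun k => ∑ s with f s = k, e s := by
  rw [CompleteOrthogonalIdempotents.iff_ortho_complete]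
  refine ⟨fun k l hkl => ?_, ?_⟩
  · simp only [Finset.sum_mul_sum]
    refine Finset.sum_eq_zero fun s hs => Finset.sum_eq_zero fun t ht => ?_
    refine he.ortho ?_
    rintro rfl
    simp only [Finset.mem_filter, Finset.mem_univ, true_and] at hs ht
    exact hkl (hs.symm.trans ht)
  · rw [Finset.sum_fiberwise, he.complete]

variable {P : κ → Matrix ι ι ℂ}

lemma isInternal_matRange [DecidableEq κ] (hP : CompleteOrthogonalIdempotents P) :
    DirectSum.IsInternal fun k => matRange (P k) := by
  refine DirectSum.isInternal_submodule_of_iSupIndep_of_iSup_eq_top ?_ ?_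
  · intro k
    -- the other ranges lie in the kernel of `P k`
    have hle : (⨆ (j) (_ : j ≠ k), matRange (P j)) ≤ LinearMap.ker (Matrix.toLin' (P k)) := by
      refine iSup₂_le fun j hj => ?_
      rintro _ ⟨u, rfl⟩
      rw [LinearMap.mem_ker, Matrix.toLin'_apply, Matrix.toLin'_apply, Matrix.mulVec_mulVec,
        hP.ortho hj.symm, Matrix.zero_mulVec]
    rw [Submodule.disjoint_def]
    intro v hv hv'
    have h0 := hle hv'
    rw [LinearMap.mem_ker, Matrix.toLin'_apply, (mem_matRange_iff (hP.idem k)).1 hv] at h0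
    exact h0
  · rw [eq_top_iff]
    intro v _
    have hv : v = ∑ k, (P k).mulVec v := by
      rw [← Matrix.sum_mulVec, hP.complete, Matrix.one_mulVec]
    rw [hv]
    exact Submodule.sum_mem _ fun k _ => Submodule.mem_iSup_of_mem k ⟨v, rfl⟩

variable {M : Matrix ι ι ℂ} {μ : κ → ℂ}

lemma eq_sum_smul_of_mul_eq (hP : CompleteOrthogonalIdempotents P)
    (hM : ∀ k, M * P k = μ k • P k) : M = ∑ k, μ k • P k := by
  rw [← Finset.sum_congr rfl fun k _ => hM k, ← Finset.mul_sum, hP.complete, mul_one]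

lemma aeval_mul_eq_smul {A : Matrix ι ι ℂ} {c : ℂ} (hA : M * A = c • A) (p : ℂ[X]) :
    aeval M p * A = p.eval c • A := by
  induction p using Polynomial.induction_on' with
  | add p q hp hq => rw [map_add, add_mul, hp, hq, eval_add, add_smul]
  | monomial n a =>
    have hpow : ∀ n : ℕ, M ^ n * A = c ^ n • A := by
      intro n
      induction n with
      | zero => simp
      | succ n ih => rw [pow_succ, mul_assoc, hA, mul_smul_comm, ih, smul_smul, pow_succ']
    rw [aeval_monomial, Algebra.algebraMap_eq_smul_one, smul_mul_assoc, one_mul, smul_mul_assoc,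
      hpow, smul_smul, eval_monomial]

lemma aeval_eq_sum_smul (hP : CompleteOrthogonalIdempotents P)
    (hM : ∀ k, M * P k = μ k • P k) (p : ℂ[X]) :
    aeval M p = ∑ k, p.eval (μ k) • P k :=
  eq_sum_smul_of_mul_eq hP fun k => aeval_mul_eq_smul (hM k) p

lemma eigSpace_eq_iSup (hP : CompleteOrthogonalIdempotents P)
    (hM : ∀ k, M * P k = μ k • P k) (c : ℂ) :
    eigSpace M c = ⨆ k : {k // μ k = c}, matRange (P k) := by
  apply le_antisymm
  · intro v hv
    rw [Module.End.mem_eigenspace_iff, Matrix.toLin'_apply] at hv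
    have hcomm : ∀ k, P k * M = μ k • P k := by
      intro k
      classical
      rw [eq_sum_smul_of_mul_eq hP hM, Finset.mul_sum]
      simp [hP.mul_eq]
    have hzero : ∀ k, μ k ≠ c → (P k).mulVec v = 0 := by
      intro k hk
      have h1 : (P k).mulVec (M.mulVec v) = μ k • (P k).mulVec v := by
        rw [Matrix.mulVec_mulVec, hcomm, Matrix.smul_mulVec]
      rw [hv, Matrix.mulVec_smul, ← sub_eq_zero, ← sub_smul] at h1
      exact (smul_eq_zero.1 h1).resolve_left (sub_ne_zero.2 (Ne.symm hk))
    have hsum : v = ∑ k, (P k).mulVec v := by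
      rw [← Matrix.sum_mulVec, hP.complete, Matrix.one_mulVec]
    rw [hsum]
    refine Submodule.sum_mem _ fun k _ => ?_
    by_cases hk : μ k = c
    · exact Submodule.mem_iSup_of_mem (⟨k, hk⟩ : {k // μ k = c}) ⟨v, rfl⟩
    · rw [hzero k hk]
      exact Submodule.zero_mem _
  · refine iSup_le ?_
    rintro ⟨k, hk⟩ _ ⟨v, rfl⟩
    rw [Module.End.mem_eigenspace_iff, Matrix.toLin'_apply, Matrix.toLin'_apply,
      Matrix.mulVec_mulVec, hM, Matrix.smul_mulVec, hk]

lemma eigSpace_eq_matRange (hP : CompleteOrthogonalIdempotents P)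
    (hM : ∀ k, M * P k = μ k • P k) (hμ : Function.Injective μ) (k : κ) :
    eigSpace M (μ k) = matRange (P k) := by
  rw [eigSpace_eq_iSup hP hM]
  apply le_antisymm
  · refine iSup_le ?_
    rintro ⟨l, hl⟩
    obtain rfl := hμ hl
    exact le_rfl
  · exact le_iSup (fun l : {l // μ l = μ k} => matRange (P l)) ⟨k, rfl⟩

lemma eigSpace_ne_bot_iff (hP : CompleteOrthogonalIdempotents P)
    (hM : ∀ k, M * P k = μ k • P k) (h0 : ∀ k, P k ≠ 0) (c : ℂ) :
    eigSpace M c ≠ ⊥ ↔ ∃ k, c = μ k := by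
  rw [eigSpace_eq_iSup hP hM, Ne, iSup_eq_bot]
  constructor
  · intro h
    push Not at h
    obtain ⟨⟨k, hk⟩, _⟩ := h
    exact ⟨k, hk.symm⟩
  · rintro ⟨k, rfl⟩ h
    exact matRange_ne_bot (h0 k) (h ⟨k, rfl⟩)

/-- A monic polynomial annihilating `M` is the minimal polynomial as soon as its roots are distinct
eigenvalues of `M`. -/
lemma minpoly_eq_prod {T : Finset ℕ} {ν : ℕ → ℂ} (hinj : Set.InjOn ν T)
    (hν : ∀ t ∈ T, ∃ A : Matrix ι ι ℂ, A ≠ 0 ∧ M * A = ν t • A)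
    (hzero : aeval M (∏ t ∈ T, (X - C (ν t))) = 0) :
    minpoly ℂ M = ∏ t ∈ T, (X - C (ν t)) := by
  refine eq_of_monic_of_associated (minpoly.monic (Matrix.isIntegral M))
    (monic_prod_of_monic _ _ fun t _ => monic_X_sub_C _)
    (associated_of_dvd_dvd (minpoly.dvd ℂ M hzero) ?_)
  refine Finset.prod_dvd_of_coprime (fun s hs t ht hst => ?_) fun t ht => ?_
  · exact isCoprime_X_sub_C_of_isUnit_sub (sub_ne_zero.2 (hinj.ne hs ht hst)).isUnit
  · rw [dvd_iff_isRoot]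
    obtain ⟨A, hA, hMA⟩ := hν t ht
    have h := aeval_mul_eq_smul hMA (minpoly ℂ M)
    rw [minpoly.aeval, zero_mul, eq_comm] at h
    exact (smul_eq_zero.1 h).resolve_right hA

/-- If a projection-valued function is continuous at `q₀`, its ranges converge to the range of its
value at `q₀`. -/
lemma isSubspaceLimit_matRange {P : ℂ → Matrix ι ι ℂ} {q₀ : ℂ} (hc : ContinuousAt P q₀)
    (hidem : ∀ᶠ q in 𝓝 q₀, P q * P q = P q) {U : ℂ → Submodule ℂ (ι → ℂ)}
    (hU : ∀ᶠ q in 𝓝[≠] q₀, U q = matRange (P q)) :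
    IsSubspaceLimit (𝓝[≠] q₀) U (matRange (P q₀)) := by
  have hc' : Tendsto P (𝓝[≠] q₀) (𝓝 (P q₀)) := hc.tendsto.mono_left nhdsWithin_le_nhds
  have hmv : Continuous fun x : Matrix ι ι ℂ × (ι → ℂ) => x.1.mulVec x.2 :=
    continuous_fst.matrix_mulVec continuous_snd
  constructor
  · intro v hv O hO
    rw [mem_matRange_iff hidem.self_of_nhds] at hv
    have h : Tendsto (fun q => (P q).mulVec v) (𝓝[≠] q₀) (𝓝 v) := by
      have := (hmv.tendsto (P q₀, v)).comp (hc'.prodMk_nhds (tendsto_const_nhds (x := v)))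
      simpa [hv] using! this
    filter_upwards [h hO, hU] with q hq hUq
    exact ⟨_, by rw [hUq]; exact ⟨v, rfl⟩, hq⟩
  · intro v hv
    rw [mem_matRange_iff hidem.self_of_nhds]
    -- otherwise `P q w ≠ w` for all `q` near `q₀` and `w` near `v`
    by_contra hne
    have hopen : ∀ᶠ x : Matrix ι ι ℂ × (ι → ℂ) in 𝓝 (P q₀, v), x.1.mulVec x.2 ≠ x.2 :=
      (isOpen_ne_fun hmv continuous_snd).mem_nhds hne
    rw [nhds_prod_eq] at hopen
    obtain ⟨pa, hpa, pb, hpb, h⟩ := eventually_prod_iff.1 hopen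
    obtain ⟨q, ⟨w, hwU, hwO⟩, hq, hUq, hid⟩ := ((hv {w | pb w} hpb).and_eventually
      ((hc'.eventually hpa).and (hU.and (hidem.filter_mono nhdsWithin_le_nhds)))).exists
    rw [SetLike.mem_coe, hUq, mem_matRange_iff hid] at hwU
    exact h hq hwO hwU

end Projections

/-! ### Splitting off the first tensor factor -/

/-- The operator `A ⊗ B` on `ℂ² ⊗ (ℂ²)^{⊗ L} = (ℂ²)^{⊗ (L + 1)}`, in the basis of spin
configurations: `A` acts on site `0`, `B` on the others. -/
def consKron {L : ℕ} (A : Matrix (Fin 2) (Fin 2) ℂ)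
    (B : Matrix (Fin L → Fin 2) (Fin L → Fin 2) ℂ) :
    Matrix (Fin (L + 1) → Fin 2) (Fin (L + 1) → Fin 2) ℂ :=
  (Matrix.kroneckerMap (· * ·) A B).submatrix (Fin.consEquiv fun _ => Fin 2).symm
    (Fin.consEquiv fun _ => Fin 2).symm

section

variable {L : ℕ} (A A' : Matrix (Fin 2) (Fin 2) ℂ)
  (B B' : Matrix (Fin L → Fin 2) (Fin L → Fin 2) ℂ)

lemma consKron_apply (s s' : Fin (L + 1) → Fin 2) :
    consKron A B s s' = A (s 0) (s' 0) * B (fun j => s j.succ) (fun j => s' j.succ) := rfl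

lemma consKron_mul : consKron A B * consKron A' B' = consKron (A * A') (B * B') := by
  rw [consKron, consKron, Matrix.submatrix_mul_equiv, consKron, Matrix.mul_kronecker_mul]

lemma consKron_one_one : consKron (1 : Matrix (Fin 2) (Fin 2) ℂ)
    (1 : Matrix (Fin L → Fin 2) (Fin L → Fin 2) ℂ) = 1 := by
  rw [consKron, Matrix.one_kronecker_one, Matrix.submatrix_one_equiv]

lemma consKron_add_left : consKron (A + A') B = consKron A B + consKron A' B := by
  ext s s'
  simp [consKron_apply, add_mul]

lemma consKron_add_right : consKron A (B + B') = consKron A B + consKron A B' := by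
  ext s s'
  simp [consKron_apply, mul_add]

lemma consKron_smul_left (c : ℂ) : consKron (c • A) B = c • consKron A B := by
  ext s s'
  simp [consKron_apply, mul_assoc]

lemma consKron_smul_right (c : ℂ) : consKron A (c • B) = c • consKron A B := by
  ext s s'
  simp [consKron_apply, mul_left_comm]

lemma consKron_zero_left : consKron 0 B = 0 := by
  ext s s'
  simp [consKron_apply]

lemma consKron_zero_right : consKron A (0 : Matrix (Fin L → Fin 2) (Fin L → Fin 2) ℂ) = 0 := by
  ext s s'
  simp [consKron_apply]

lemma consKron_sum_right {σ : Type} (T : Finset σ)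
    (B : σ → Matrix (Fin L → Fin 2) (Fin L → Fin 2) ℂ) :
    consKron A (∑ j ∈ T, B j) = ∑ j ∈ T, consKron A (B j) := by
  ext s s'
  simp [consKron_apply, Matrix.sum_apply, Finset.mul_sum]

variable {A B} in
lemma consKron_ne_zero (hA : A ≠ 0) (hB : B ≠ 0) : consKron A B ≠ 0 := by
  intro h
  obtain ⟨i, hi⟩ := Function.ne_iff.1 hA
  obtain ⟨j, hij⟩ := Function.ne_iff.1 hi
  obtain ⟨s, hs⟩ := Function.ne_iff.1 hB
  obtain ⟨s', hss⟩ := Function.ne_iff.1 hs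
  have := congrFun (congrFun h (Fin.cons i s)) (Fin.cons j s')
  rw [consKron_apply] at this
  simp only [Fin.cons_zero, Fin.cons_succ, Matrix.zero_apply] at this
  exact mul_ne_zero hij hss this

lemma ContinuousAt.consKron {A : ℂ → Matrix (Fin 2) (Fin 2) ℂ}
    {B : ℂ → Matrix (Fin L → Fin 2) (Fin L → Fin 2) ℂ} {q₀ : ℂ}
    (hA : ContinuousAt A q₀) (hB : ContinuousAt B q₀) :
    ContinuousAt (fun q => consKron (A q) (B q)) q₀ := by
  refine continuousAt_pi.2 fun s => continuousAt_pi.2 fun s' => ?_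
  exact (continuousAt_pi.1 (continuousAt_pi.1 hA _) _).mul
    (continuousAt_pi.1 (continuousAt_pi.1 hB _) _)

end

lemma tensorOp_succ {L : ℕ} (A : Fin (L + 1) → Matrix (Fin 2) (Fin 2) ℂ) :
    tensorOp A = consKron (A 0) (tensorOp fun j => A j.succ) := by
  ext s s'
  simp [tensorOp, consKron_apply, Fin.prod_univ_succ]

lemma tensorOp_one {L : ℕ} : tensorOp (fun _ : Fin L => 1) = 1 := by
  induction L with
  | zero =>
    ext s s'
    obtain rfl := Subsingleton.elim s s'
    simp [tensorOp]
  | succ L ih => rw [tensorOp_succ, ih, consKron_one_one]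

lemma chainOp_zero (kp km ε r : ℂ) : chainOp 0 kp km ε r = ε • 1 := by
  ext s s'
  obtain rfl := Subsingleton.elim s s'
  simp [chainOp, tensorOp]

/-- The chain operators satisfy `𝒲^{(L+1)} = w₀ ⊗ 1 + r^{σ_z} ⊗ 𝒲^{(L)}`. -/
lemma chainOp_succ (L : ℕ) (kp km ε r : ℂ) :
    chainOp (L + 1) kp km ε r =
      consKron (w0 kp km) 1 + consKron (qSigmaZ r) (chainOp L kp km ε r) := by
  rw [chainOp, Fin.sum_univ_succ, tensorOp_succ, tensorOp_succ (fun _ => qSigmaZ r), chainOp,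
    consKron_add_right, consKron_smul_right, consKron_sum_right, add_assoc]
  congr 1
  · rw [← tensorOp_one]
    simp [Fin.succ_ne_zero]
  · congr 1
    refine Finset.sum_congr rfl fun j _ => ?_
    rw [tensorOp_succ]
    simp [Fin.succ_pos]

/-! ### Spectral projections of a `2 × 2` matrix -/

/-- For a `2 × 2` matrix `M` with eigenvalues `x ≠ y`, the projection onto the eigenspace of `x`
along that of `y`. -/
noncomputable def twoProj (M : Matrix (Fin 2) (Fin 2) ℂ) (x y : ℂ) : Matrix (Fin 2) (Fin 2) ℂ :=
  (x - y)⁻¹ • (M - y • 1)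

section

variable {M : Matrix (Fin 2) (Fin 2) ℂ} {x y : ℂ}

/-- Cayley–Hamilton for a `2 × 2` matrix. -/
lemma sub_smul_mul_sub_smul_eq_zero (htr : M.trace = x + y) (hdet : M.det = x * y) :
    (M - x • 1) * (M - y • 1) = 0 := by
  rw [Matrix.trace_fin_two] at htr
  rw [Matrix.det_fin_two] at hdet
  ext i j
  fin_cases i <;> fin_cases j <;> simp [Matrix.mul_apply, Fin.sum_univ_two]
  · linear_combination M 0 0 * htr - hdet
  · linear_combination M 0 1 * htr
  · linear_combination M 1 0 * htr
  · linear_combination M 1 1 * htr - hdet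

lemma mul_twoProj (htr : M.trace = x + y) (hdet : M.det = x * y) :
    M * twoProj M x y = x • twoProj M x y := by
  have h := sub_smul_mul_sub_smul_eq_zero htr hdet
  rw [sub_mul, sub_eq_zero, smul_mul_assoc, one_mul] at h
  rw [twoProj, mul_smul_comm, h, smul_comm]

lemma twoProj_mul_twoProj (htr : M.trace = x + y) (hdet : M.det = x * y) :
    twoProj M x y * twoProj M y x = 0 := by
  rw [twoProj, twoProj, smul_mul_smul_comm, sub_smul_mul_sub_smul_eq_zero, smul_zero]
  · rw [htr, add_comm]
  · rw [hdet, mul_comm]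

lemma twoProj_add_twoProj (hxy : x ≠ y) : twoProj M x y + twoProj M y x = 1 := by
  have h : x - y ≠ 0 := sub_ne_zero.2 hxy
  rw [twoProj, twoProj, ← neg_sub x y, inv_neg, neg_smul, ← sub_eq_add_neg, ← smul_sub,
    sub_sub_sub_cancel_left, ← sub_smul, smul_smul, inv_mul_cancel₀ h, one_smul]

lemma twoProj_ne_zero (htr : M.trace = x + y) (hxy : x ≠ y) : twoProj M x y ≠ 0 := by
  have h : x - y ≠ 0 := sub_ne_zero.2 hxy
  intro h0
  have := congrArg Matrix.trace h0
  rw [twoProj, Matrix.trace_smul, Matrix.trace_sub, htr, Matrix.trace_smul,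
    Matrix.trace_one] at this
  simp at this
  rcases this with h1 | h1
  · exact h h1
  · exact h (by linear_combination h1)

end

/-! ### The eigenvalues `θ_n(q)` -/

section

variable (L : ℕ) (a b : ℂ → ℂ)

lemma theta_sub_theta {q : ℂ} (hq : q ≠ 0) (n m : ℕ) :
    theta L a b n q - theta L a b m q =
      (q ^ ((m : ℤ) - n) - q ^ ((n : ℤ) - m)) *
        (a q * q ^ ((L : ℤ) - n - m) - b q * q ^ (-((L : ℤ) - n - m))) := by
  have h1 : q ^ ((L : ℤ) - 2 * n) = q ^ ((m : ℤ) - n) * q ^ ((L : ℤ) - n - m) := by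
    rw [← zpow_add₀ hq]; congr 1; ring
  have h2 : q ^ (-(L : ℤ) + 2 * n) = q ^ ((n : ℤ) - m) * q ^ (-((L : ℤ) - n - m)) := by
    rw [← zpow_add₀ hq]; congr 1; ring
  have h3 : q ^ ((L : ℤ) - 2 * m) = q ^ ((n : ℤ) - m) * q ^ ((L : ℤ) - n - m) := by
    rw [← zpow_add₀ hq]; congr 1; ring
  have h4 : q ^ (-(L : ℤ) + 2 * m) = q ^ ((m : ℤ) - n) * q ^ (-((L : ℤ) - n - m)) := by
    rw [← zpow_add₀ hq]; congr 1; ring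
  rw [theta, theta, h1, h2, h3, h4]
  ring

lemma theta_succ_left {q : ℂ} (hq : q ≠ 0) (n : ℕ) :
    theta (L + 1) a b n q =
      a q * q ^ ((L : ℤ) - 2 * n) * q + b q * q ^ (-((L : ℤ) - 2 * n)) * q⁻¹ := by
  rw [theta, mul_assoc, mul_assoc, ← zpow_add_one₀ hq, ← zpow_sub_one₀ hq]
  push_cast
  congr 3 <;> ring

lemma theta_succ_succ {q : ℂ} (hq : q ≠ 0) (n : ℕ) :
    theta (L + 1) a b (n + 1) q =
      a q * q ^ ((L : ℤ) - 2 * n) * q⁻¹ + b q * q ^ (-((L : ℤ) - 2 * n)) * q := by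
  rw [theta, mul_assoc, mul_assoc, ← zpow_add_one₀ hq, ← zpow_sub_one₀ hq]
  push_cast
  congr 3 <;> ring

lemma theta_eq (n : ℕ) (q : ℂ) :
    theta L a b n q = a q * q ^ ((L : ℤ) - 2 * n) + b q * q ^ (-((L : ℤ) - 2 * n)) := by
  rw [theta, neg_sub', sub_neg_eq_add]

lemma theta_succ_ne {q : ℂ} (hq : q ≠ 0) (hq2 : q - q⁻¹ ≠ 0)
    (hgen : ∀ k : ℤ, a q * q ^ k ≠ b q * q ^ (-k)) (n : ℕ) :
    theta (L + 1) a b n q ≠ theta (L + 1) a b (n + 1) q := by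
  rw [← sub_ne_zero, theta_succ_left L a b hq, theta_succ_succ L a b hq]
  have h := mul_ne_zero hq2 (sub_ne_zero.2 (hgen ((L : ℤ) - 2 * n)))
  intro h'
  exact h (by linear_combination h')

variable {a b}

lemma continuousAt_theta {q₀ : ℂ} (hq : q₀ ≠ 0) (ha : ContinuousAt a q₀) (hb : ContinuousAt b q₀)
    (n : ℕ) : ContinuousAt (theta L a b n) q₀ :=
  (ha.mul (continuousAt_zpow₀ _ _ (.inl hq))).add (hb.mul (continuousAt_zpow₀ _ _ (.inl hq)))

end

/-! ### A continuous family of spectral projections of the chain operator -/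

/-- The `2 × 2` matrix by which `w₀ ⊗ 1 + r^{σ_z} ⊗ 𝒲` acts on `ℂ² ⊗ v`, where `𝒲 v = c v`. -/
noncomputable def siteOp (kp km r c : ℂ) : Matrix (Fin 2) (Fin 2) ℂ := w0 kp km + c • qSigmaZ r

lemma siteOp_trace (kp km r c : ℂ) : (siteOp kp km r c).trace = c * (r + r⁻¹) := by
  simp [siteOp, w0, qSigmaZ, Matrix.trace_fin_two]
  ring

lemma siteOp_det (kp km c : ℂ) {r : ℂ} (hr : r ≠ 0) :
    (siteOp kp km r c).det = c ^ 2 - kp * km := by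
  simp [siteOp, w0, qSigmaZ, Matrix.det_fin_two]
  field_simp

/-- If `v` is an eigenvector for `θ_n` of the chain of length `L`, then on `ℂ² ⊗ v` the chain of
length `L + 1` has the eigenvalues `θ_n` and `θ_{n+1}` that belong to the length `L + 1`. -/
lemma siteOp_theta (L n : ℕ) (a b : ℂ → ℂ) {kp km r q : ℂ} (hq : q ≠ 0)
    (hq2 : q - q⁻¹ ≠ 0) (hr : r ≠ 0) (hrq : r + r⁻¹ = q + q⁻¹)
    (hab : a q * b q = -(kp * km) / (q - q⁻¹) ^ 2) :
    (siteOp kp km r (theta L a b n q)).trace =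
        theta (L + 1) a b n q + theta (L + 1) a b (n + 1) q ∧
      (siteOp kp km r (theta L a b n q)).det =
        theta (L + 1) a b n q * theta (L + 1) a b (n + 1) q := by
  rw [siteOp_trace, siteOp_det _ _ _ hr, hrq, theta_succ_left L a b hq, theta_succ_succ L a b hq,
    theta_eq]
  have hz : q ^ ((L : ℤ) - 2 * n) * q ^ (-((L : ℤ) - 2 * n)) = 1 := by
    rw [← zpow_add₀ hq, add_neg_cancel, zpow_zero]
  have hab' : kp * km = -(a q * b q * (q - q⁻¹) ^ 2) := by
    rw [hab, div_mul_cancel₀ _ (pow_ne_zero 2 hq2), neg_neg]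
  have hqq : q * q⁻¹ = 1 := mul_inv_cancel₀ hq
  generalize q ^ ((L : ℤ) - 2 * n) = u at *
  generalize q ^ (-((L : ℤ) - 2 * n)) = v at *
  generalize q⁻¹ = p at *
  constructor
  · ring
  · rw [hab']
    linear_combination (-(a q ^ 2 * u ^ 2 + b q ^ 2 * v ^ 2) + -2 * (a q * b q)) * hqq +
      (a q * b q) * (2 - q ^ 2 - p ^ 2) * hz

lemma chainOp_succ_mul_consKron {L : ℕ} {kp km ε r c x : ℂ} {Q : Matrix (Fin 2) (Fin 2) ℂ}
    {E : Matrix (Fin L → Fin 2) (Fin L → Fin 2) ℂ} (hE : chainOp L kp km ε r * E = c • E)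
    (hQ : siteOp kp km r c * Q = x • Q) :
    chainOp (L + 1) kp km ε r * consKron Q E = x • consKron Q E := by
  rw [chainOp_succ, add_mul, consKron_mul, consKron_mul, hE, one_mul, consKron_smul_right,
    ← consKron_smul_left, ← consKron_add_left, ← smul_mul_assoc, ← add_mul, ← siteOp, hQ,
    consKron_smul_left]

lemma ContinuousAt.twoProj {M : ℂ → Matrix (Fin 2) (Fin 2) ℂ} {x y : ℂ → ℂ} {q₀ : ℂ}
    (hM : ContinuousAt M q₀) (hx : ContinuousAt x q₀) (hy : ContinuousAt y q₀)
    (hxy : x q₀ ≠ y q₀) : ContinuousAt (fun q => twoProj (M q) (x q) (y q)) q₀ :=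
  ((hx.sub hy).inv₀ (sub_ne_zero.2 hxy)).smul (hM.sub (hy.smul continuousAt_const))

lemma ContinuousAt.siteOp {kp km r c : ℂ → ℂ} {q₀ : ℂ} (hkp : ContinuousAt kp q₀)
    (hkm : ContinuousAt km q₀) (hr : ContinuousAt r q₀) (hr0 : r q₀ ≠ 0)
    (hc : ContinuousAt c q₀) :
    ContinuousAt (fun q => siteOp (kp q) (km q) (r q) (c q)) q₀ := by
  have hK : ContinuousAt (fun q => qSigmaZ (r q)) q₀ := by
    refine continuousAt_pi.2 fun i => continuousAt_pi.2 fun j => ?_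
    have h : ContinuousAt (fun q => (r q)⁻¹) q₀ := hr.inv₀ hr0
    fin_cases i <;> fin_cases j <;> simp [qSigmaZ, continuousAt_const, hr, h]
  exact ((hkp.smul continuousAt_const).add (hkm.smul continuousAt_const)).add (hc.smul hK)

/-- Adding one site splits each spectral projection `E s` of the chain, of eigenvalue
`θ_{wt s}`, into two: `Q ⊗ E s`, for the two spectral projections `Q` of the `2 × 2` matrix
`siteOp`. The weight `wt s` counts how often the second of them was chosen. All projections are
continuous at `q₀`, although eigenvalues of the chain may collide there: the two eigenvalues of each
`siteOp` stay distinct. -/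
lemma exists_projections {q₀ ε : ℂ} {kp km r a b : ℂ → ℂ} (hq₀ : q₀ ≠ 0) (hq2 : q₀ - q₀⁻¹ ≠ 0)
    (hkp : ContinuousAt kp q₀) (hkm : ContinuousAt km q₀)
    (hr : ContinuousAt r q₀) (hr0 : r q₀ ≠ 0) (hrq : ∀ q, r q + (r q)⁻¹ = q + q⁻¹)
    (ha : ContinuousAt a q₀) (hb : ContinuousAt b q₀)
    (hsum : ∀ᶠ q in 𝓝 q₀, a q + b q = ε)
    (hprod : ∀ᶠ q in 𝓝 q₀, a q * b q = -(kp q * km q) / (q - q⁻¹) ^ 2)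
    (hgen : ∀ k : ℤ, a q₀ * q₀ ^ k ≠ b q₀ * q₀ ^ (-k)) (L : ℕ) :
    ∃ (σ : Type) (_ : Fintype σ) (wt : σ → ℕ)
      (E : σ → ℂ → Matrix (Fin L → Fin 2) (Fin L → Fin 2) ℂ),
      (∀ s, wt s ≤ L) ∧ (∀ n ≤ L, ∃ s, wt s = n) ∧ (∀ s, ContinuousAt (E s) q₀) ∧
      ∀ᶠ q in 𝓝 q₀, CompleteOrthogonalIdempotents (fun s => E s q) ∧ (∀ s, E s q ≠ 0) ∧
        ∀ s, chainOp L (kp q) (km q) ε (r q) * E s q = theta L a b (wt s) q • E s q := by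
  induction L with
  | zero =>
    refine ⟨Unit, inferInstance, fun _ => 0, fun _ _ => 1, fun _ => le_rfl,
      fun n hn => ⟨(), (Nat.le_zero.1 hn).symm⟩, fun _ => continuousAt_const, ?_⟩
    filter_upwards [hsum] with q hq
    refine ⟨CompleteOrthogonalIdempotents.unique_iff.2 rfl, fun _ => one_ne_zero, fun _ => ?_⟩
    rw [chainOp_zero, mul_one, ← hq]
    simp [theta]
  | succ L ih =>
    obtain ⟨σ, _, wt, E, hwt, hsurj, hcont, hE⟩ := ih
    classical
    let x : σ → ℂ → ℂ := fun s => theta (L + 1) a b (wt s)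
    let y : σ → ℂ → ℂ := fun s => theta (L + 1) a b (wt s + 1)
    let M : σ → ℂ → Matrix (Fin 2) (Fin 2) ℂ := fun s q =>
      siteOp (kp q) (km q) (r q) (theta L a b (wt s) q)
    let Q : Bool → σ → ℂ → Matrix (Fin 2) (Fin 2) ℂ := fun t s q =>
      bif t then twoProj (M s q) (y s q) (x s q) else twoProj (M s q) (x s q) (y s q)
    have hx : ∀ s, ContinuousAt (x s) q₀ := fun s => continuousAt_theta _ hq₀ ha hb _
    have hy : ∀ s, ContinuousAt (y s) q₀ := fun s => continuousAt_theta _ hq₀ ha hb _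
    have hM : ∀ s, ContinuousAt (M s) q₀ := fun s =>
      ContinuousAt.siteOp hkp hkm hr hr0 (continuousAt_theta _ hq₀ ha hb _)
    have hxy : ∀ s, x s q₀ ≠ y s q₀ := fun s => theta_succ_ne L a b hq₀ hq2 hgen _
    have hxy' : ∀ᶠ q in 𝓝 q₀, ∀ s, x s q ≠ y s q :=
      eventually_all.2 fun s =>
      (((hx s).sub (hy s)).eventually_ne (sub_ne_zero.2 (hxy s))).mono fun q h => sub_ne_zero.1 h
    refine ⟨Bool × σ, inferInstance, fun p => wt p.2 + bif p.1 then 1 else 0,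
      fun p q => consKron (Q p.1 p.2 q) (E p.2 q), ?_, ?_, ?_, ?_⟩
    · rintro ⟨t, s⟩
      have := hwt s
      cases t <;> simp <;> omega
    · intro n hn
      rcases Nat.lt_or_ge L n with h | h
      · obtain ⟨s, hs⟩ := hsurj L le_rfl
        exact ⟨(true, s), by simp [hs]; omega⟩
      · obtain ⟨s, hs⟩ := hsurj n h
        exact ⟨(false, s), by simp [hs]⟩
    · rintro ⟨t, s⟩
      refine ContinuousAt.consKron ?_ (hcont s)
      cases t
      · exact ContinuousAt.twoProj (hM s) (hx s) (hy s) (hxy s)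
      · exact ContinuousAt.twoProj (hM s) (hy s) (hx s) (hxy s).symm
    · have hq2' : ∀ᶠ q in 𝓝 q₀, q - q⁻¹ ≠ 0 :=
        (continuousAt_id.sub (continuousAt_inv₀ hq₀)).eventually_ne hq2
      filter_upwards [hE, hxy', hprod, hq2', hr.eventually_ne hr0,
        continuousAt_id.eventually_ne hq₀] with q ⟨hP, hne, heig⟩ hxyq hpr hq2q hrq0 hq0
      have htd := fun s => siteOp_theta L (wt s) a b hq0 hq2q hrq0 (hrq q) hpr
      have htr : ∀ s, (M s q).trace = x s q + y s q := fun s => (htd s).1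
      have hdet : ∀ s, (M s q).det = x s q * y s q := fun s => (htd s).2
      have htr' : ∀ s, (M s q).trace = y s q + x s q := fun s => by rw [htr, add_comm]
      have hdet' : ∀ s, (M s q).det = y s q * x s q := fun s => by rw [hdet, mul_comm]
      refine ⟨CompleteOrthogonalIdempotents.iff_ortho_complete.2 ⟨?_, ?_⟩, ?_, ?_⟩
      · rintro ⟨t, s⟩ ⟨t', s'⟩ hne'
        rw [consKron_mul]
        by_cases hs : s = s'
        · subst hs
          have hQ : Q t s q * Q t' s q = 0 := by
            cases t <;> cases t'
            · exact absurd rfl hne'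
            · exact twoProj_mul_twoProj (htr s) (hdet s)
            · exact twoProj_mul_twoProj (htr' s) (hdet' s)
            · exact absurd rfl hne'
          rw [hQ, consKron_zero_left]
        · rw [hP.ortho hs, consKron_zero_right]
      · rw [Fintype.sum_prod_type, Fintype.sum_bool, ← Finset.sum_add_distrib]
        simp only [← consKron_add_left]
        rw [← consKron_one_one, ← hP.complete, consKron_sum_right]
        refine Finset.sum_congr rfl fun s _ => ?_
        congr 1
        exact twoProj_add_twoProj (hxyq s).symm
      · rintro ⟨t, s⟩
        refine consKron_ne_zero ?_ (hne s)
        cases t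
        · exact twoProj_ne_zero (htr s) (hxyq s)
        · exact twoProj_ne_zero (htr' s) (hxyq s).symm
      · rintro ⟨t, s⟩
        refine chainOp_succ_mul_consKron (heig s) ?_
        cases t
        · exact mul_twoProj (htr s) (hdet s)
        · exact mul_twoProj (htr' s) (hdet' s)

/-- The eigenprojections of the chain operator for `θ_0(q), …, θ_L(q)`, continuous at `q₀`. -/
lemma exists_spectral_projections {q₀ ε : ℂ} {kp km r a b : ℂ → ℂ} (hq₀ : q₀ ≠ 0)
    (hq2 : q₀ - q₀⁻¹ ≠ 0) (hkp : ContinuousAt kp q₀) (hkm : ContinuousAt km q₀)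
    (hr : ContinuousAt r q₀) (hr0 : r q₀ ≠ 0) (hrq : ∀ q, r q + (r q)⁻¹ = q + q⁻¹)
    (ha : ContinuousAt a q₀) (hb : ContinuousAt b q₀)
    (hsum : ∀ᶠ q in 𝓝 q₀, a q + b q = ε)
    (hprod : ∀ᶠ q in 𝓝 q₀, a q * b q = -(kp q * km q) / (q - q⁻¹) ^ 2)
    (hgen : ∀ k : ℤ, a q₀ * q₀ ^ k ≠ b q₀ * q₀ ^ (-k)) (L : ℕ) :
    ∃ P : Fin (L + 1) → ℂ → Matrix (Fin L → Fin 2) (Fin L → Fin 2) ℂ,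
      (∀ n, ContinuousAt (P n) q₀) ∧
      ∀ᶠ q in 𝓝 q₀, CompleteOrthogonalIdempotents (fun n => P n q) ∧ (∀ n, P n q ≠ 0) ∧
        ∀ n, chainOp L (kp q) (km q) ε (r q) * P n q = theta L a b n q • P n q := by
  obtain ⟨σ, _, wt, E, hwt, hsurj, hcont, hE⟩ :=
    exists_projections hq₀ hq2 hkp hkm hr hr0 hrq ha hb hsum hprod hgen L
  classical
  let f : σ → Fin (L + 1) := fun s => ⟨wt s, Nat.lt_succ_of_le (hwt s)⟩
  refine ⟨fun n q => ∑ s with f s = n, E s q,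
    fun n => tendsto_finsetSum _ fun s _ => hcont s, ?_⟩
  filter_upwards [hE] with q ⟨hP, hne, heig⟩
  refine ⟨CompleteOrthogonalIdempotents.sum_fiber hP f, fun n h0 => ?_, fun n => ?_⟩
  · obtain ⟨s, hs⟩ := hsurj n (Nat.le_of_lt_succ n.2)
    have hmem : s ∈ Finset.univ.filter fun s => f s = n := by
      simp [f, Fin.ext_iff, hs]
    have h := hP.mul_sum_of_mem hmem
    rw [h0, mul_zero] at h
    exact hne s h.symm
  · rw [Finset.mul_sum, Finset.smul_sum]
    refine Finset.sum_congr rfl fun s hs => ?_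
    rw [heig, ← (Finset.mem_filter.1 hs).2]

/-! ### The root of unity `e^{iπ/N}` -/

lemma rootq_isPrimitiveRoot {N : ℕ} (hN : N ≠ 0) : IsPrimitiveRoot (rootq N) (2 * N) := by
  have h := Complex.isPrimitiveRoot_exp (2 * N) (by omega)
  have hN' : (N : ℂ) ≠ 0 := Nat.cast_ne_zero.2 hN
  rw [rootq]
  convert h using 2
  push_cast
  field_simp

lemma rootq_ne_zero (N : ℕ) : rootq N ≠ 0 := Complex.exp_ne_zero _

lemma rootq_pow {N : ℕ} (hN : N ≠ 0) : rootq N ^ N = -1 := by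
  have hN' : (N : ℂ) ≠ 0 := Nat.cast_ne_zero.2 hN
  rw [rootq, ← Complex.exp_nat_mul, mul_div_cancel₀ _ hN', mul_comm, Complex.exp_pi_mul_I]

lemma rootq_zpow_mul {N : ℕ} (hN : N ≠ 0) (k : ℤ) : (rootq N ^ k) ^ N = (-1) ^ k := by
  rw [← zpow_natCast, ← zpow_mul, mul_comm, zpow_mul, zpow_natCast, rootq_pow hN]

lemma rootq_zpow_sub_zpow_ne_zero {N : ℕ} (hN : N ≠ 0) {k : ℤ} (hk : ¬ (N : ℤ) ∣ k) :
    rootq N ^ k - rootq N ^ (-k) ≠ 0 := by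
  intro h
  have hq := rootq_ne_zero N
  have h1 : rootq N ^ (k + k) = 1 := by
    rw [zpow_add₀ hq]
    nth_rw 1 [sub_eq_zero.1 h]
    rw [← zpow_add₀ hq, neg_add_cancel, zpow_zero]
  rw [(rootq_isPrimitiveRoot hN).zpow_eq_one_iff_dvd] at h1
  push_cast at h1
  rw [← two_mul] at h1
  exact hk (Int.dvd_of_mul_dvd_mul_left (by norm_num) h1)

lemma rootq_sub_inv_ne_zero {N : ℕ} (hN : 2 < N) : rootq N - (rootq N)⁻¹ ≠ 0 := by
  have h := rootq_zpow_sub_zpow_ne_zero (N := N) (by omega) (k := 1) (by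
    intro h
    have := Int.le_of_dvd one_pos h
    omega)
  simpa using h

lemma qFactorial_ne_zero {N : ℕ} (hN : 2 < N) : qFactorial (N - 1) (rootq N) ≠ 0 := by
  refine Finset.prod_ne_zero_iff.2 fun l hl => div_ne_zero ?_ (rootq_sub_inv_ne_zero hN)
  rw [Finset.mem_Icc] at hl
  have h := rootq_zpow_sub_zpow_ne_zero (N := N) (by omega) (k := l) (by
    intro h
    have := Int.le_of_dvd (by omega) h
    omega)
  simpa using h

section

variable {L N : ℕ} {a b : ℂ → ℂ}

lemma mul_zpow_ne_mul_zpow (hN : N ≠ 0) (hgen : a (rootq N) ^ N ≠ b (rootq N) ^ N) (k : ℤ) :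
    a (rootq N) * rootq N ^ k ≠ b (rootq N) * rootq N ^ (-k) := by
  intro h
  have h' := congrArg (· ^ N) h
  have hk : ((-1 : ℂ) ^ k) ≠ 0 := zpow_ne_zero _ (by norm_num)
  have hk' : (-1 : ℂ) ^ (-k) = (-1) ^ k := by rw [zpow_neg, ← inv_zpow, inv_neg, inv_one]
  simp only [mul_pow, rootq_zpow_mul hN, hk'] at h'
  exact hgen (mul_right_cancel₀ hk h')

lemma rootq_zpow_mod (hN : N ≠ 0) (L n : ℕ) :
    rootq N ^ ((L : ℤ) - 2 * (n % N : ℕ)) = rootq N ^ ((L : ℤ) - 2 * n) := by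
  have h : (L : ℤ) - 2 * (n % N : ℕ) = (L - 2 * n) + (2 * N : ℕ) * (n / N : ℕ) := by
    have := Nat.mod_add_div n N
    zify at this ⊢
    linear_combination -2 * this
  rw [h, zpow_add₀ (rootq_ne_zero N), zpow_mul, zpow_natCast, zpow_natCast,
    (rootq_isPrimitiveRoot hN).pow_eq_one, one_pow, mul_one]

lemma theta_mod (hN : N ≠ 0) (n : ℕ) :
    theta L a b (n % N) (rootq N) = theta L a b n (rootq N) := by
  rw [theta_eq, theta_eq, zpow_neg, zpow_neg, rootq_zpow_mod hN]

lemma theta_injOn (hN : N ≠ 0) (hgen : a (rootq N) ^ N ≠ b (rootq N) ^ N) :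
    Set.InjOn (fun t => theta L a b t (rootq N)) (Finset.range N) := by
  intro s hs t ht hst
  simp only [Finset.coe_range, Set.mem_Iio] at hs ht
  by_contra hne
  have h := sub_eq_zero.2 hst
  simp only at h
  rw [theta_sub_theta L a b (rootq_ne_zero N), mul_eq_zero, sub_eq_zero (b := b _ * _)] at h
  refine h.elim ?_ (mul_zpow_ne_mul_zpow hN hgen _)
  rw [← neg_sub (t : ℤ) s]
  refine rootq_zpow_sub_zpow_ne_zero hN fun hd => ?_
  have := Int.eq_zero_of_abs_lt_dvd hd (by rw [abs_lt]; omega)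
  omega

/-- For `k ≠ 0` the zeros of `q ↦ q ^ k - q ^ (-k)` are isolated. -/
lemma eventually_zpow_sub_zpow_ne_zero {q₀ : ℂ} (hq₀ : q₀ ≠ 0) {k : ℤ} (hk : k ≠ 0) :
    ∀ᶠ q in 𝓝[≠] q₀, q ^ k - q ^ (-k) ≠ 0 := by
  have hd := (hasDerivAt_zpow k q₀ (.inl hq₀)).sub (hasDerivAt_zpow (-k) q₀ (.inl hq₀))
  by_cases h : q₀ ^ k - q₀ ^ (-k) = 0
  · refine hd.eventually_ne ?_
    rw [zpow_sub_one₀ hq₀, zpow_sub_one₀ hq₀, ← sub_eq_zero.1 h]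
    have h1 : (2 : ℂ) * k * (q₀ ^ k * q₀⁻¹) ≠ 0 :=
      mul_ne_zero (mul_ne_zero two_ne_zero (Int.cast_ne_zero.2 hk))
        (mul_ne_zero (zpow_ne_zero _ hq₀) (inv_ne_zero hq₀))
    intro h2
    push_cast at h2
    exact h1 (by linear_combination h2)
  · exact (hd.continuousAt.eventually_ne h).filter_mono nhdsWithin_le_nhds

/-- Away from `q₀`, near `q₀`, no two of finitely many `θ_n(q)` agree. -/
lemma eventually_theta_injective (hN : N ≠ 0) (ha : ContinuousAt a (rootq N))
    (hb : ContinuousAt b (rootq N)) (hgen : a (rootq N) ^ N ≠ b (rootq N) ^ N) :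
    ∀ᶠ q in 𝓝[≠] (rootq N), Function.Injective fun n : Fin (L + 1) => theta L a b n q := by
  have hq := rootq_ne_zero N
  have h : ∀ n m : Fin (L + 1), ∀ᶠ q in 𝓝[≠] (rootq N),
      theta L a b n q = theta L a b m q → n = m := by
    intro n m
    by_cases hnm : n = m
    · exact Eventually.of_forall fun _ _ => hnm
    have hk : ((m : ℕ) : ℤ) - (n : ℕ) ≠ 0 := by
      intro h
      exact hnm (Fin.ext (by omega))
    have hc : ∀ k : ℤ, ContinuousAt (fun q : ℂ => q ^ k) (rootq N) :=
      fun k => continuousAt_zpow₀ _ _ (.inl hq)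
    have hg : ∀ᶠ q in 𝓝[≠] (rootq N), a q * q ^ ((L : ℤ) - (n : ℕ) - (m : ℕ)) -
        b q * q ^ (-((L : ℤ) - (n : ℕ) - (m : ℕ))) ≠ 0 :=
      (((ha.mul (hc _)).sub (hb.mul (hc _))).eventually_ne
        (sub_ne_zero.2 (mul_zpow_ne_mul_zpow hN hgen _))).filter_mono nhdsWithin_le_nhds
    filter_upwards [eventually_zpow_sub_zpow_ne_zero hq hk, hg,
      (eventually_ne_nhds hq).filter_mono nhdsWithin_le_nhds] with q h1 h2 h3 h4
    rw [← sub_eq_zero, theta_sub_theta L a b h3, ← neg_sub ((m : ℕ) : ℤ)] at h4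
    exact absurd h4 (mul_ne_zero h1 h2)
  filter_upwards [eventually_all.2 fun n => eventually_all.2 (h n)] with q hq n m
  exact hq n m

/-! ### The eigenvalues of the divided polynomial -/

lemma eval_polyP_theta (hN : N ≠ 0) (n : ℕ) :
    (polyP L N a b).eval (theta L a b n (rootq N)) = 0 := by
  rw [← theta_mod hN]
  exact Lagrange.eval_nodal_at_node (v := fun j => theta L a b j (rootq N))
    (Finset.mem_range.2 (Nat.mod_lt n (Nat.pos_of_ne_zero hN)))

lemma eval_derivative_polyP_theta (hN : N ≠ 0) (n : ℕ) :
    (derivative (polyP L N a b)).eval (theta L a b n (rootq N)) =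
      ∏ j ∈ (Finset.range N).erase (n % N),
        (theta L a b (n % N) (rootq N) - theta L a b j (rootq N)) := by
  rw [← theta_mod hN]
  have h := Lagrange.eval_nodal_derivative_eval_node_eq (v := fun j => theta L a b j (rootq N))
    (Finset.mem_range.2 (Nat.mod_lt n (Nat.pos_of_ne_zero hN)))
  rw [Lagrange.eval_nodal] at h
  exact h

lemma hasDerivAt_theta {q₀ ε : ℂ} (hq₀ : q₀ ≠ 0) (ha : DifferentiableAt ℂ a q₀)
    (hsum : ∀ᶠ q in 𝓝 q₀, a q + b q = ε) (n : ℕ) :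
    HasDerivAt (theta L a b n)
      (deriv a q₀ * (q₀ ^ ((L : ℤ) - 2 * n) - q₀ ^ (-(L : ℤ) + 2 * n)) +
        ((L : ℂ) - 2 * n) *
          (a q₀ * q₀ ^ ((L : ℤ) - 2 * n) - b q₀ * q₀ ^ (-(L : ℤ) + 2 * n)) * q₀⁻¹) q₀ := by
  have hb : HasDerivAt b (-deriv a q₀) q₀ := by
    refine (ha.hasDerivAt.const_sub ε).congr_of_eventuallyEq ?_
    filter_upwards [hsum] with q hq
    rw [← hq, add_sub_cancel_left]
  have h := (ha.hasDerivAt.mul (hasDerivAt_zpow ((L : ℤ) - 2 * n) q₀ (.inl hq₀))).add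
    (hb.mul (hasDerivAt_zpow (-(L : ℤ) + 2 * n) q₀ (.inl hq₀)))
  refine h.congr_deriv ?_
  rw [zpow_sub_one₀ hq₀, zpow_sub_one₀ hq₀]
  push_cast
  ring

lemma tendsto_div_of_hasDerivAt {f g : ℂ → ℂ} {f' g' x : ℂ} (hf : HasDerivAt f f' x)
    (hg : HasDerivAt g g' x) (hf0 : f x = 0) (hg0 : g x = 0) (hg' : g' ≠ 0) :
    Tendsto (fun y => f y / g y) (𝓝[≠] x) (𝓝 (f' / g')) := by
  refine ((hasDerivAt_iff_tendsto_slope.1 hf).div (hasDerivAt_iff_tendsto_slope.1 hg) hg').congr' ?_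
  filter_upwards [self_mem_nhdsWithin] with y hy
  rw [Pi.div_apply, slope_def_field, slope_def_field, hf0, hg0, sub_zero, sub_zero,
    div_div_div_cancel_right₀ (sub_ne_zero.2 hy)]

lemma continuousAt_qFactorial (hN : 2 < N) (n : ℕ) : ContinuousAt (qFactorial n) (rootq N) := by
  have hq := rootq_ne_zero N
  refine tendsto_finsetProd _ fun l _ => ?_
  exact ((continuousAt_id.pow l).sub ((continuousAt_id.pow l).inv₀ (pow_ne_zero _ hq))).div
    (continuousAt_id.sub (continuousAt_inv₀ hq)) (rootq_sub_inv_ne_zero hN)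

/-- Both `P_N(θ_n(q))` and `[N]_q` vanish at `q₀`; the limit of the quotient is that of the
derivatives. -/
lemma tendsto_eval_polyP_div_qFactorial {ε : ℂ} (hN : 2 < N) (ha : DifferentiableAt ℂ a (rootq N))
    (hsum : ∀ᶠ q in 𝓝 (rootq N), a q + b q = ε) (n : ℕ) :
    Tendsto (fun q => (qFactorial N q)⁻¹ * (polyP L N a b).eval (theta L a b n q))
      (𝓝[≠] (rootq N)) (𝓝 (thetaTilde L N a b n)) := by
  have hN0 : N ≠ 0 := by omega
  have hq := rootq_ne_zero N
  have hqN := rootq_pow hN0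
  have hF := ((polyP L N a b).hasDerivAt (theta L a b n (rootq N))).comp (rootq N)
    (hasDerivAt_theta (L := L) hq ha hsum n)
  have hh := (hasDerivAt_pow N (rootq N)).sub
    ((hasDerivAt_pow N (rootq N)).inv (pow_ne_zero N hq))
  have hpred : rootq N ^ (N - 1) = -(rootq N)⁻¹ := by
    rw [pow_sub₀ _ hq (by omega), hqN, pow_one, neg_one_mul]
  have hh' := hh.congr_deriv (g' := -(2 * N * (rootq N)⁻¹)) (by
    rw [hpred, hqN]
    ring)
  have hNC : (N : ℂ) ≠ 0 := Nat.cast_ne_zero.2 hN0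
  have hlim := tendsto_div_of_hasDerivAt hF hh' (eval_polyP_theta hN0 n) (by simp [hqN])
    (neg_ne_zero.2 (mul_ne_zero (mul_ne_zero two_ne_zero hNC) (inv_ne_zero hq)))
  have hfac : Tendsto (fun q => (qFactorial (N - 1) q)⁻¹ * (q - q⁻¹)) (𝓝[≠] (rootq N))
      (𝓝 ((qFactorial (N - 1) (rootq N))⁻¹ * (rootq N - (rootq N)⁻¹))) :=
    (((continuousAt_qFactorial hN (N - 1)).inv₀ (qFactorial_ne_zero hN)).mul
      (continuousAt_id.sub (continuousAt_inv₀ hq))).tendsto.mono_left nhdsWithin_le_nhds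
  have h := hfac.mul hlim
  refine (h.congr fun q => ?_).trans (le_of_eq (congrArg 𝓝 ?_))
  · obtain ⟨M, rfl⟩ : ∃ M, N = M + 1 := ⟨N - 1, by omega⟩
    rw [qFactorial, qFactorial, Nat.add_sub_cancel, Finset.prod_Icc_succ_top (by omega), qNumber]
    simp only [Function.comp, Pi.sub_apply, Pi.inv_apply, mul_inv, inv_div]
    ring
  · rw [eval_derivative_polyP_theta hN0, thetaTilde, coeffC0, zpow_add_one₀ hq, zpow_add_one₀ hq]
    have := qFactorial_ne_zero hN
    field_simp

/-! ### The arithmetic progression -/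

lemma prod_sub_pow_mul {ζ : ℂ} (hN : N ≠ 0) (hζ : IsPrimitiveRoot ζ N) (x z : ℂ) :
    ∏ j ∈ Finset.range N, (x - ζ ^ j * z) = x ^ N - z ^ N := by
  have h := congrArg (eval x) (X_pow_sub_C_eq_prod hζ (Nat.pos_of_ne_zero hN) (rfl : z ^ N = _))
  rw [eval_prod] at h
  simpa using h.symm

lemma prod_erase_sub_pow_mul {ζ : ℂ} (hN : N ≠ 0) (hζ : IsPrimitiveRoot ζ N) (z : ℂ) {t : ℕ}
    (ht : t < N) :
    ∏ j ∈ (Finset.range N).erase t, (ζ ^ t * z - ζ ^ j * z) = N * (ζ ^ t * z) ^ (N - 1) := by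
  have h := Lagrange.eval_nodal_derivative_eval_node_eq (v := fun j => ζ ^ j * z)
    (Finset.mem_range.2 ht)
  rw [Lagrange.eval_nodal, Lagrange.nodal_eq,
    ← X_pow_sub_C_eq_prod hζ (Nat.pos_of_ne_zero hN) (rfl : z ^ N = _)] at h
  rw [← h, derivative_sub, derivative_C, derivative_X_pow]
  simp

/-- With `y_j = q₀^{L - 2j}` one has `θ_t - θ_j = (y_t - y_j) (a - b / (y_t y_j))`, and the `y_j`
are, up to a common factor, the `N`-th roots of unity. So the product of the differences can be
evaluated, and it depends on `t` only through the factor `a y_t - b / y_t`. -/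
lemma prod_theta_sub_mul (hN : N ≠ 0) (L n : ℕ) (a b : ℂ → ℂ) :
    (∏ j ∈ (Finset.range N).erase (n % N),
        (theta L a b (n % N) (rootq N) - theta L a b j (rootq N))) *
      (a (rootq N) * rootq N ^ ((L : ℤ) - 2 * n) - b (rootq N) * rootq N ^ (-(L : ℤ) + 2 * n)) =
    N * (-1) ^ L * (a (rootq N) ^ N - b (rootq N) ^ N) := by
  have hq := rootq_ne_zero N
  rw [show -(L : ℤ) + 2 * n = -((L : ℤ) - 2 * n) by ring, zpow_neg, ← rootq_zpow_mod hN]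
  set t := n % N with ht
  have htN : t < N := Nat.mod_lt n (Nat.pos_of_ne_zero hN)
  set q := rootq N
  have hζ : IsPrimitiveRoot (q ^ 2) N :=
    (rootq_isPrimitiveRoot hN).pow (by omega) rfl
  have hζ0 : q ^ 2 ≠ 0 := pow_ne_zero 2 hq
  set ζ := q ^ 2 with hζdef
  set z := q ^ L with hz
  have hz0 : z ≠ 0 := pow_ne_zero L hq
  have hzN : z ^ N = (-1) ^ L := by rw [hz, ← pow_mul, mul_comm, pow_mul, rootq_pow hN]
  have hy : ∀ j : ℕ, q ^ ((L : ℤ) - 2 * j) = ζ⁻¹ ^ j * z := by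
    intro j
    rw [zpow_sub₀ hq, zpow_natCast, zpow_mul, zpow_natCast, inv_pow, div_eq_inv_mul]
    rfl
  have hθ : ∀ j, theta L a b j q = a q * (ζ⁻¹ ^ j * z) + b q * (ζ⁻¹ ^ j * z)⁻¹ := by
    intro j
    rw [theta_eq, zpow_neg, hy]
  set y := ζ⁻¹ ^ t * z with hyt
  have hy0 : y ≠ 0 := mul_ne_zero (pow_ne_zero _ (inv_ne_zero hζ0)) hz0
  have hyN : y ^ N = (-1) ^ L := by
    rw [hyt, mul_pow, ← pow_mul, mul_comm t, pow_mul, hζ.inv.pow_eq_one, one_pow, one_mul, hzN]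
  have hdiff : ∀ j, theta L a b t q - theta L a b j q =
      (y - ζ⁻¹ ^ j * z) * (a q - ζ ^ j * (b q / (y * z))) := by
    intro j
    have hw0 : ζ⁻¹ ^ j * z ≠ 0 := mul_ne_zero (pow_ne_zero _ (inv_ne_zero hζ0)) hz0
    have hw : ζ ^ j * (b q / (y * z)) = b q / (y * (ζ⁻¹ ^ j * z)) := by
      have := pow_ne_zero j hζ0
      rw [inv_pow]
      field_simp
    rw [hθ, hθ, ← hyt, hw]
    generalize ζ⁻¹ ^ j * z = w at hw0
    field_simp
    ring
  have hlast : a q * y - b q * y⁻¹ = y * (a q - ζ ^ t * (b q / (y * z))) := by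
    rw [hyt, inv_pow]
    have := pow_ne_zero t hζ0
    field_simp
  rw [hy, Finset.prod_congr rfl fun j _ => hdiff j, Finset.prod_mul_distrib, hlast,
    prod_erase_sub_pow_mul hN hζ.inv z htN]
  have hprod := Finset.prod_erase_mul (Finset.range N)
    (fun j => a q - ζ ^ j * (b q / (y * z))) (Finset.mem_range.2 htN)
  rw [prod_sub_pow_mul hN hζ, div_pow, mul_pow, hyN, hzN, ← mul_pow, neg_one_mul, neg_neg,
    one_pow, div_one] at hprod
  calc _ = N * (y ^ (N - 1) * y) * ((∏ j ∈ (Finset.range N).erase t,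
        (a q - ζ ^ j * (b q / (y * z)))) * (a q - ζ ^ t * (b q / (y * z)))) := by ring
    _ = _ := by rw [hprod, pow_sub_one_mul hN, hyN]

/-- If `a'(q₀) = 0`, then `θ̃_n` is `L - 2n` times a nonzero constant. -/
lemma exists_thetaTilde_eq (hN : 2 < N) (hgen : a (rootq N) ^ N ≠ b (rootq N) ^ N)
    (hda : deriv a (rootq N) = 0) (L : ℕ) :
    ∃ d : ℂ, d ≠ 0 ∧ ∀ n : ℕ, thetaTilde L N a b n = thetaTilde L N a b 0 + n * d := by
  have hN0 : N ≠ 0 := by omega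
  set c : ℂ := -(rootq N - (rootq N)⁻¹) / (2 * N * qFactorial (N - 1) (rootq N)) with hc
  have hc0 : c ≠ 0 := div_ne_zero (neg_ne_zero.2 (rootq_sub_inv_ne_zero hN))
    (mul_ne_zero (mul_ne_zero two_ne_zero (Nat.cast_ne_zero.2 hN0)) (qFactorial_ne_zero hN))
  set e : ℂ := N * (-1) ^ L * (a (rootq N) ^ N - b (rootq N) ^ N) with he
  have he0 : e ≠ 0 := mul_ne_zero (mul_ne_zero (Nat.cast_ne_zero.2 hN0)
    (pow_ne_zero _ (by norm_num))) (sub_ne_zero.2 hgen)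
  have key : ∀ n : ℕ, thetaTilde L N a b n = c * e * ((L : ℂ) - 2 * n) := by
    intro n
    rw [thetaTilde, coeffC0, hda, ← hc, he, ← prod_theta_sub_mul hN0 L n a b]
    ring
  refine ⟨-2 * (c * e), mul_ne_zero (by norm_num) (mul_ne_zero hc0 he0), fun n => ?_⟩
  rw [key, key, Nat.cast_zero]
  ring

end

end OpenXXZ

/-! ### The spectrum at the root of unity -/

theorem mainTheorem8 (L N : ℕ) (hN : 2 < N) (kp km : ℂ → ℂ) (ε : Fin 2 → ℂ) (i : Fin 2)
    (a₂ a₃ : ℂ → ℂ)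
    (hkp : ContinuousAt kp (rootq N)) (hkm : ContinuousAt km (rootq N))
    (ha₂ : DifferentiableAt ℂ a₂ (rootq N))
    (hsum : ∀ᶠ q in 𝓝 (rootq N), a₂ q + a₃ q = ε i)
    (hprod : ∀ᶠ q in 𝓝 (rootq N), a₂ q * a₃ q = -(kp q * km q) / (q - q⁻¹) ^ 2)
    (hgen : a₂ (rootq N) ^ N ≠ a₃ (rootq N) ^ N) :
    -- for `q ≠ e^{iπ/N}` near `e^{iπ/N}`, the operator is diagonalizable with the `L + 1` distinct
    -- eigenvalues `θ_n(q)`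
    (∀ᶠ q in 𝓝[≠] (rootq N),
      (Function.Injective fun n : Fin (L + 1) => theta L a₂ a₃ n q) ∧
      (∀ n : Fin (L + 1), eigSpace (basicOp L kp km ε i q) (theta L a₂ a₃ n q) ≠ ⊥) ∧
      DirectSum.IsInternal fun n : Fin (L + 1) =>
        eigSpace (basicOp L kp km ε i q) (theta L a₂ a₃ n q)) ∧
    -- `P_N` at the root of unity
    (Function.Injective fun t : Fin N => theta L a₂ a₃ t (rootq N)) ∧
    aeval (basicOp L kp km ε i (rootq N)) (polyP L N a₂ a₃) = 0 ∧
    (N ≤ L + 1 → minpoly ℂ (basicOp L kp km ε i (rootq N)) = polyP L N a₂ a₃) ∧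
    -- the divided polynomial `D` and the limits `V n` of the eigenspaces exist
    ∃ (D : Matrix (Fin L → Fin 2) (Fin L → Fin 2) ℂ)
      (V : Fin (L + 1) → Submodule ℂ ((Fin L → Fin 2) → ℂ)),
      Tendsto (fun q => (qFactorial N q)⁻¹ • aeval (basicOp L kp km ε i q) (polyP L N a₂ a₃))
        (𝓝[≠] (rootq N)) (𝓝 D) ∧
      (∀ n : Fin (L + 1), IsSubspaceLimit (𝓝[≠] (rootq N))
        (fun q => eigSpace (basicOp L kp km ε i q) (theta L a₂ a₃ n q)) (V n)) ∧
      (∀ n, V n ≠ ⊥) ∧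
      DirectSum.IsInternal V ∧
      -- spectrum and eigenspaces of `D`
      (∀ n, ∀ v ∈ V n, D.mulVec v = thetaTilde L N a₂ a₃ n • v) ∧
      (∀ μ : ℂ, eigSpace D μ ≠ ⊥ ↔ ∃ n : Fin (L + 1), μ = thetaTilde L N a₂ a₃ n) ∧
      (∀ n : Fin (L + 1), eigSpace D (thetaTilde L N a₂ a₃ n) =
        ⨆ m : {m : Fin (L + 1) // thetaTilde L N a₂ a₃ m = thetaTilde L N a₂ a₃ n}, V m) ∧
      ((Function.Injective fun n : Fin (L + 1) => thetaTilde L N a₂ a₃ n) →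
        ∀ n : Fin (L + 1), eigSpace D (thetaTilde L N a₂ a₃ n) = V n) ∧
      -- if `a₂'(e^{iπ/N}) = 0`, in particular if `a₃ = 0` near `e^{iπ/N}`: arithmetic progression
      (deriv a₂ (rootq N) = 0 ∨ (∀ᶠ q in 𝓝 (rootq N), a₃ q = 0) →
        (∃ d : ℂ, d ≠ 0 ∧ ∀ n : Fin (L + 1),
          thetaTilde L N a₂ a₃ n = thetaTilde L N a₂ a₃ 0 + n * d) ∧
        ∀ n : Fin (L + 1), eigSpace D (thetaTilde L N a₂ a₃ n) = V n) := by
  have hN0 : N ≠ 0 := by omega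
  have hq := rootq_ne_zero N
  have hq2 := rootq_sub_inv_ne_zero hN
  have hca := ha₂.continuousAt
  have hcb : ContinuousAt a₃ (rootq N) := by
    have hc : ContinuousAt (fun q => ε i - a₂ q) (rootq N) := continuousAt_const.sub hca
    refine hc.congr ?_
    filter_upwards [hsum] with q h
    rw [← h, add_sub_cancel_left]
  have hr : ContinuousAt (fun q : ℂ => if i = 0 then q else q⁻¹) (rootq N) := by
    split_ifs
    exacts [continuousAt_id, continuousAt_inv₀ hq]
  have hr0 : (if i = 0 then rootq N else (rootq N)⁻¹) ≠ 0 := by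
    split_ifs
    exacts [hq, inv_ne_zero hq]
  have hrq : ∀ q : ℂ, (if i = 0 then q else q⁻¹) + (if i = 0 then q else q⁻¹)⁻¹ = q + q⁻¹ := by
    intro q
    split_ifs
    · rfl
    · rw [inv_inv, add_comm]
  obtain ⟨P, hPc, hP⟩ := exists_spectral_projections hq hq2 hkp hkm hr hr0 hrq hca hcb hsum hprod
    (mul_zpow_ne_mul_zpow hN0 hgen) L
  have hPW : ∀ᶠ q in 𝓝 (rootq N), CompleteOrthogonalIdempotents (fun n => P n q) ∧
      (∀ n, P n q ≠ 0) ∧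
      ∀ n : Fin (L + 1), basicOp L kp km ε i q * P n q = theta L a₂ a₃ n q • P n q := hP
  have hinj := eventually_theta_injective (L := L) hN0 hca hcb hgen
  have heigU : ∀ᶠ q in 𝓝[≠] (rootq N), ∀ n : Fin (L + 1),
      eigSpace (basicOp L kp km ε i q) (theta L a₂ a₃ n q) = matRange (P n q) := by
    filter_upwards [hPW.filter_mono nhdsWithin_le_nhds, hinj] with q ⟨h1, _, h3⟩ hi n
    exact eigSpace_eq_matRange h1 h3 hi n
  obtain ⟨hP₀, hne₀, hW₀⟩ := hPW.self_of_nhds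
  have hzero : aeval (basicOp L kp km ε i (rootq N)) (polyP L N a₂ a₃) = 0 := by
    rw [aeval_eq_sum_smul hP₀ hW₀]
    exact Finset.sum_eq_zero fun n _ => by rw [eval_polyP_theta hN0, zero_smul]
  have hinj₀ := theta_injOn (L := L) hN0 hgen
  set D := ∑ n : Fin (L + 1), thetaTilde L N a₂ a₃ n • P n (rootq N) with hD
  have hDP : ∀ n : Fin (L + 1), D * P n (rootq N) = thetaTilde L N a₂ a₃ n • P n (rootq N) := by
    intro n
    rw [hD, Finset.sum_mul]
    simp [hP₀.mul_eq]
  refine ⟨?_, ?_, hzero, ?_, D, fun n => matRange (P n (rootq N)), ?_, ?_, ?_, ?_, ?_, ?_, ?_, ?_,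
    ?_⟩
  · filter_upwards [hPW.filter_mono nhdsWithin_le_nhds, hinj, heigU] with q ⟨h1, h2, _⟩ hi hU
    refine ⟨hi, fun n => ?_, ?_⟩
    · rw [hU]
      exact matRange_ne_bot (h2 n)
    · simp only [hU]
      exact isInternal_matRange h1
  · intro s t hst
    exact Fin.ext (hinj₀ (by simp) (by simp) hst)
  · intro hNL
    refine minpoly_eq_prod hinj₀ (fun t ht => ?_) hzero
    have ht' : t < L + 1 := (Finset.mem_range.1 ht).trans_le hNL
    exact ⟨P ⟨t, ht'⟩ (rootq N), hne₀ _, hW₀ ⟨t, ht'⟩⟩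
  · have hlim : Tendsto (fun q => ∑ n : Fin (L + 1), ((qFactorial N q)⁻¹ *
        (polyP L N a₂ a₃).eval (theta L a₂ a₃ n q)) • P n q) (𝓝[≠] (rootq N)) (𝓝 D) :=
      tendsto_finsetSum _ fun n _ => (tendsto_eval_polyP_div_qFactorial hN ha₂ hsum n).smul
        ((hPc n).tendsto.mono_left nhdsWithin_le_nhds)
    refine hlim.congr' ?_
    filter_upwards [hPW.filter_mono nhdsWithin_le_nhds] with q ⟨h1, _, h3⟩
    rw [aeval_eq_sum_smul h1 h3, Finset.smul_sum]
    simp only [smul_smul]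
  · exact fun n => isSubspaceLimit_matRange (hPc n) (hPW.mono fun q h => h.1.idem n)
      (heigU.mono fun q h => h n)
  · exact fun n => matRange_ne_bot (hne₀ n)
  · exact isInternal_matRange hP₀
  · rintro n _ ⟨v, rfl⟩
    rw [Matrix.toLin'_apply, Matrix.mulVec_mulVec, hDP, Matrix.smul_mulVec]
  · exact eigSpace_ne_bot_iff hP₀ hDP hne₀
  · exact fun n => eigSpace_eq_iSup hP₀ hDP _
  · exact fun hi n => eigSpace_eq_matRange hP₀ hDP hi n
  · intro h
    have hda : deriv a₂ (rootq N) = 0 := by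
      rcases h with h | h
      · exact h
      · -- if `a₃ = 0` near `q₀`, then `a₂ = ε i` near `q₀`
        have hconst : a₂ =ᶠ[𝓝 (rootq N)] fun _ => ε i := by
          filter_upwards [hsum, h] with q h1 h2
          rw [← h1, h2, add_zero]
        rw [hconst.deriv_eq, deriv_const]
    obtain ⟨d, hd, hθ⟩ := exists_thetaTilde_eq hN hgen hda L
    refine ⟨⟨d, hd, fun n => hθ n⟩, fun n => eigSpace_eq_matRange hP₀ hDP ?_ n⟩
    intro n m hnm
    simp only [hθ n, hθ m] at hnm
    exact Fin.ext (Nat.cast_injective (mul_right_cancel₀ hd (add_left_cancel hnm)))
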